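/- Let $\mathbb F$ be a field and let $\mathcal L=\bigoplus_{i\ge 1}\mathcal L_i$ be an $\mathbb N$-graded Lie algebra over $\mathbb F$ (that is, $[\mathcal L_i,\mathcal L_j]\subseteq \mathcal L_{i+j}$ for all $i,j\geq 1$) which is $1$-generated, i.e. generated as a Lie algebra by $\mathcal L_1$. Let $H^2(\mathcal L,\mathbb F)=\operatorname{Ext}^2_{\mathcal U(\mathcal L)}(\mathbb F,\mathbb F)$ be its second cohomology group with trivial coefficients, where $\mathcal U(\mathcal L)$ is the universal enveloping algebra, acting on $\mathbb F$ through the augmentation. Then $H^2(\mathcal L,\mathbb F)=0$ if and only if $\mathcal L$ is free on $\mathcal L_1$, meaning that the canonical homomorphism from the free Lie algebra on the vector space $\mathcal L_1$ to $\mathcal L$, which extends the inclusion $\mathcal L_1\hookrightarrow\mathcal L$, is an isomorphism. Equivalently, $H^2(\mathcal L,\mathbb F)=0$ if and only if $\mathcal L$ is isomorphic, as an ungraded Lie algebra, to the free Lie algebra $\mathcal L\langle X\rangle$ on some set $X$. -/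

import Mathlib

open CategoryTheory

universe u v w

noncomputable section

namespace GradedLie

section Cohomology

variable (F : Type u) [Field F] (L : Type v) [LieRing L] [LieAlgebra F L]

/-- The augmentation `ε : U(L) → F` of the universal enveloping algebra: the homomorphism of unital
associative algebras that sends every element of `L` to `0`. -/
def augmentation : UniversalEnvelopingAlgebra F L →ₐ[F] F :=
  letI : LieRing F := LieRing.ofAssociativeRing
  UniversalEnvelopingAlgebra.lift F (0 : L →ₗ⁅F⁆ F)

/-- The trivial `U(L)`-module `F`: the field `F`, on which `U(L)` acts through the augmentation.
(`ULift` only places `F` in the same universe as `U(L)`.) -/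
def trivialModule : ModuleCat.{max u v} (UniversalEnvelopingAlgebra F L) :=
  (ModuleCat.restrictScalars (augmentation F L).toRingHom).obj
    (ModuleCat.of F (ULift.{v} F))

/-- The Lie algebra cohomology `Hⁿ(L, F) = Extⁿ_{U(L)}(F, F)` with trivial coefficients. -/
abbrev Cohomology (n : ℕ) : Type (max u v) :=
  Abelian.Ext (trivialModule F L) (trivialModule F L) n

end Cohomology

section FreeLie

variable (F : Type u) [Field F] (V : Type v) [AddCommGroup V] [Module F V]

/-- The ideal of the free Lie algebra on the underlying set of `V` generated by the elements that
express the linearity of the inclusion of `V`. -/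
def linearityIdeal : LieIdeal F (FreeLieAlgebra F V) :=
  LieSubmodule.lieSpan F (FreeLieAlgebra F V)
    ({z | ∃ x y : V, z = FreeLieAlgebra.of F (x + y) -
        (FreeLieAlgebra.of F x + FreeLieAlgebra.of F y)} ∪
      {z | ∃ (c : F) (x : V), z = FreeLieAlgebra.of F (c • x) - c • FreeLieAlgebra.of F x})

/-- The free Lie algebra on the vector space `V`. -/
abbrev FreeLieOn : Type (max u v) := FreeLieAlgebra F V ⧸ linearityIdeal F V

variable {F V}
variable {M : Type w} [LieRing M] [LieAlgebra F M]

theorem linearityIdeal_le_ker (f : V →ₗ[F] M) :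
    linearityIdeal F V ≤ (FreeLieAlgebra.lift F (f : V → M)).ker := by
  refine LieSubmodule.lieSpan_le.mpr ?_
  rintro z (⟨x, y, rfl⟩ | ⟨c, x, rfl⟩) <;> simp [LieHom.mem_ker]

/-- The homomorphism of Lie algebras from the free Lie algebra on `V` to `M` that extends a given
linear map `f : V → M`. -/
def FreeLieOn.lift (f : V →ₗ[F] M) : FreeLieOn F V →ₗ⁅F⁆ M :=
  { Submodule.liftQ (linearityIdeal F V).toSubmodule
      (FreeLieAlgebra.lift F (f : V → M) : FreeLieAlgebra F V →ₗ[F] M)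
      (fun _ hz => linearityIdeal_le_ker f hz) with
    map_lie' := by
      rintro ⟨x⟩ ⟨y⟩
      exact LieHom.map_lie (FreeLieAlgebra.lift F (f : V → M)) x y }

end FreeLie

section Graded

variable {F : Type u} [Field F] {L : Type v} [LieRing L] [LieAlgebra F L]

/-- `L = ⨁ ℒ i` is `1`-generated: no proper Lie subalgebra contains the component of degree `1`. -/
def IsOneGenerated (ℒ : ℕ → Submodule F L) : Prop :=
  LieSubalgebra.lieSpan F L (ℒ 1 : Set L) = ⊤

/-- The canonical homomorphism from the free Lie algebra on the vector space `ℒ 1` to `L`, which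
restricts to the inclusion on `ℒ 1`. -/
def canonicalHom (ℒ : ℕ → Submodule F L) : FreeLieOn F (ℒ 1) →ₗ⁅F⁆ L :=
  FreeLieOn.lift (ℒ 1).subtype

end Graded

end GradedLie

end

/-! Let `I` be the augmentation ideal of `U = U(L)`. A basis `B` of `ℒ 1` generates `L`, so `(a_b) ↦
∑ a_b b` maps `U^(B)` onto `I`; let `K` be its kernel. If `H²` vanishes, dimension shifting along `0
→ I → U → F → 0` shows that every `U`-linear map `K → F` extends to `U^(B)`. But `K ⊆ I^(B)`,
because brackets have no component of degree 1, and `I` kills `F`; hence `Hom_U(K, F) = 0`, so `K =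
IK`, and a degree argument of Nakayama type gives `K = 0` (`toAugmentationIdeal_injective`).

Thus `I` is free on `B`, and the free associative algebra on `B` embeds in `U`
(`lift_injective_of_linearCombination_injective`). The free Lie algebra embeds in the free
associative one (`toFreeAlgebra_injective`, by Lazard elimination). The composite embedding factors
through `canonicalHom`, which is therefore injective; it is surjective by 1-generation.

Conversely, if `L` is free on any set `X`, the universal derivation splits `U^(X) → I`. So `I` is
projective, `F` has a projective resolution of length one and `Ext²` vanishes. This direction
ignores the grading, whence the ungraded criterion. -/

noncomputable section

namespace GradedLie

attribute [local instance] LieRing.ofAssociativeRing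

/-! ### The free Lie algebra embeds in the free associative algebra. -/

section Embedding

variable (R : Type u) [CommRing R] {X : Type v}

/-- The canonical homomorphism from the free Lie algebra to the free associative algebra. -/
def toFreeAlgebra (X : Type v) : FreeLieAlgebra R X →ₗ⁅R⁆ FreeAlgebra R X :=
  FreeLieAlgebra.lift R (FreeAlgebra.ι R)

@[simp]
theorem toFreeAlgebra_of (x : X) :
    toFreeAlgebra R X (FreeLieAlgebra.of R x) = FreeAlgebra.ι R x :=
  FreeLieAlgebra.lift_of_apply _ _

/-- The Lie monomial in the free Lie algebra given by a bracketing of letters. -/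
def monomial : FreeMagma X → FreeLieAlgebra R X
  | .of x => FreeLieAlgebra.of R x
  | .mul a b => ⁅monomial a, monomial b⁆

/-- The multiset of letters of a bracketing. -/
def content : FreeMagma X → Multiset X
  | .of x => {x}
  | .mul a b => content a + content b

theorem monomial_mul (a b : FreeMagma X) :
    monomial R (a * b) = ⁅monomial R a, monomial R b⁆ :=
  rfl

theorem content_mul (a b : FreeMagma X) : content (a * b) = content a + content b :=
  rfl

theorem content_ne_zero (m : FreeMagma X) : content m ≠ 0 := by
  induction m with
  | ih1 x => simp [content]
  | ih2 a b ha hb => simp [content_mul, ha]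

/-- The span of the Lie monomials with `n` letters. -/
def lengthSpan (X : Type v) (n : ℕ) : Submodule R (FreeLieAlgebra R X) :=
  Submodule.span R (monomial R '' {m | (content m).card = n})

variable {R}

theorem lie_mem_of_mem_span {M : Type w} [LieRing M] [LieAlgebra R M] {s t : Set M}
    {p : Submodule R M} (h : ∀ a ∈ s, ∀ b ∈ t, ⁅a, b⁆ ∈ p) {a b : M}
    (ha : a ∈ Submodule.span R s) (hb : b ∈ Submodule.span R t) : ⁅a, b⁆ ∈ p := by
  induction ha using Submodule.span_induction with
  | mem a ha =>
    induction hb using Submodule.span_induction with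
    | mem b hb => exact h a ha b hb
    | zero => simp
    | add x y _ _ hx hy => rw [lie_add]; exact add_mem hx hy
    | smul c x _ hx => rw [lie_smul]; exact p.smul_mem c hx
  | zero => simp
  | add x y _ _ hx hy => rw [add_lie]; exact add_mem hx hy
  | smul c x _ hx => rw [smul_lie]; exact p.smul_mem c hx

theorem monomial_mem_lengthSpan (m : FreeMagma X) :
    monomial R m ∈ lengthSpan R X (content m).card :=
  Submodule.subset_span ⟨m, rfl, rfl⟩

theorem lie_mem_lengthSpan {j k : ℕ} {a b : FreeLieAlgebra R X} (ha : a ∈ lengthSpan R X j)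
    (hb : b ∈ lengthSpan R X k) : ⁅a, b⁆ ∈ lengthSpan R X (j + k) := by
  refine lie_mem_of_mem_span ?_ ha hb
  rintro _ ⟨m, rfl, rfl⟩ _ ⟨m', rfl, rfl⟩
  have := monomial_mem_lengthSpan (R := R) (m * m')
  simpa [monomial_mul, content_mul] using this

theorem lieSpan_range_of :
    LieSubalgebra.lieSpan R (FreeLieAlgebra R X) (Set.range (FreeLieAlgebra.of R)) = ⊤ := by
  set S := LieSubalgebra.lieSpan R (FreeLieAlgebra R X) (Set.range (FreeLieAlgebra.of R))
  let g : FreeLieAlgebra R X →ₗ⁅R⁆ S := FreeLieAlgebra.lift R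
    (fun x => ⟨FreeLieAlgebra.of R x, LieSubalgebra.subset_lieSpan ⟨x, rfl⟩⟩)
  have h : S.incl.comp g = LieHom.id := by
    ext x
    simp [g]
  refine eq_top_iff.mpr fun a _ => ?_
  have := DFunLike.congr_fun h a
  rw [← show S.incl (g a) = a from this]
  exact (g a).2

theorem span_range_monomial : Submodule.span R (Set.range (monomial R (X := X))) = ⊤ := by
  let S : LieSubalgebra R (FreeLieAlgebra R X) :=
    { Submodule.span R (Set.range (monomial R (X := X))) with
      lie_mem' := fun {a b} ha hb => by
        refine lie_mem_of_mem_span ?_ ha hb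
        rintro _ ⟨m, rfl⟩ _ ⟨m', rfl⟩
        exact Submodule.subset_span ⟨m * m', rfl⟩ }
  have h : (⊤ : LieSubalgebra R (FreeLieAlgebra R X)) ≤ S := by
    rw [← lieSpan_range_of, LieSubalgebra.lieSpan_le]
    rintro _ ⟨x, rfl⟩
    exact Submodule.subset_span ⟨.of x, rfl⟩
  exact eq_top_iff.mpr fun a _ => h (show a ∈ (⊤ : LieSubalgebra R _) from trivial)

/-- The homomorphism that records the multidegree. -/
def multidegree (R : Type u) [CommRing R] (X : Type v) :
    FreeAlgebra R X →ₐ[R] AddMonoidAlgebra (FreeAlgebra R X) (Multiset X) :=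
  FreeAlgebra.lift R fun x => AddMonoidAlgebra.single {x} (FreeAlgebra.ι R x)

theorem multidegree_monomial (m : FreeMagma X) :
    multidegree R X (toFreeAlgebra R X (monomial R m)) =
      AddMonoidAlgebra.single (content m) (toFreeAlgebra R X (monomial R m)) := by
  induction m with
  | ih1 x => simp [monomial, content, multidegree]
  | ih2 a b ha hb =>
    rw [monomial_mul, content_mul, LieHom.map_lie, LieRing.of_associative_ring_bracket, map_sub,
      map_mul, map_mul, ha, hb, AddMonoidAlgebra.single_mul_single,
      AddMonoidAlgebra.single_mul_single, add_comm (content b), ← AddMonoidAlgebra.single_sub]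

/-- The letters of the elimination of `x`: `(n, y)` stands for `ad(x)ⁿ y`. -/
abbrev Eliminated (x : X) : Type v := ℕ × {y : X // y ≠ x}

/-- The substitution of `ad(x)ⁿ y` for the letter `(n, y)`. -/
def substitute (R : Type u) [CommRing R] (x : X) :
    FreeLieAlgebra R (Eliminated x) →ₗ⁅R⁆ FreeLieAlgebra R X :=
  FreeLieAlgebra.lift R fun z =>
    ((LieAlgebra.ad R _ (FreeLieAlgebra.of R x)) ^ z.1) (FreeLieAlgebra.of R z.2.1)

theorem substitute_of (x : X) (n : ℕ) (y : {y : X // y ≠ x}) :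
    substitute R x (FreeLieAlgebra.of R (n, y)) =
      ((LieAlgebra.ad R _ (FreeLieAlgebra.of R x)) ^ n) (FreeLieAlgebra.of R y.1) :=
  FreeLieAlgebra.lift_of_apply _ _

theorem lie_substitute_of (x : X) (n : ℕ) (y : {y : X // y ≠ x}) :
    ⁅FreeLieAlgebra.of R x, substitute R x (FreeLieAlgebra.of R (n, y))⁆ =
      substitute R x (FreeLieAlgebra.of R (n + 1, y)) := by
  rw [substitute_of, substitute_of, pow_succ', Module.End.mul_apply, LieAlgebra.ad_apply]

/-- The elements of degree `k` in the letters other than `x`. -/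
def eliminationSpan (R : Type u) [CommRing R] (x : X) (k : ℕ) :
    Submodule R (FreeLieAlgebra R X) :=
  if k = 0 then R ∙ FreeLieAlgebra.of R x
  else (lengthSpan R (Eliminated x) k).map (substitute R x : _ →ₗ[R] FreeLieAlgebra R X)

theorem eliminationSpan_zero (x : X) :
    eliminationSpan R x 0 = R ∙ FreeLieAlgebra.of R x :=
  if_pos rfl

theorem eliminationSpan_of_ne_zero (x : X) {k : ℕ} (hk : k ≠ 0) :
    eliminationSpan R x k =
      (lengthSpan R (Eliminated x) k).map (substitute R x : _ →ₗ[R] FreeLieAlgebra R X) :=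
  if_neg hk

/-- By the Leibniz rule, `ad x` replaces one letter `(n, y)` at a time by `(n + 1, y)`, which keeps
the length. -/
theorem lie_of_substitute_monomial (x : X) (m : FreeMagma (Eliminated x)) :
    ⁅FreeLieAlgebra.of R x, substitute R x (monomial R m)⁆ ∈
      (lengthSpan R (Eliminated x) (content m).card).map
        (substitute R x : _ →ₗ[R] FreeLieAlgebra R X) := by
  induction m with
  | ih1 z =>
    obtain ⟨n, y⟩ := z
    refine ⟨_, monomial_mem_lengthSpan (FreeMagma.of (n + 1, y)), ?_⟩
    exact (lie_substitute_of x n y).symm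
  | ih2 a b ha hb =>
    obtain ⟨a', ha', ha⟩ := ha
    obtain ⟨b', hb', hb⟩ := hb
    rw [content_mul, Multiset.card_add]
    refine ⟨⁅a', monomial R b⁆ + ⁅monomial R a, b'⁆,
      add_mem (lie_mem_lengthSpan ha' (monomial_mem_lengthSpan b))
        (lie_mem_lengthSpan (monomial_mem_lengthSpan a) hb'), ?_⟩
    simp only [LieHom.coe_toLinearMap] at ha hb ⊢
    rw [map_add, LieHom.map_lie, LieHom.map_lie, ha, hb, monomial_mul, LieHom.map_lie,
      leibniz_lie (FreeLieAlgebra.of R x)]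

theorem lie_of_mem_eliminationSpan (x : X) {k : ℕ} {b : FreeLieAlgebra R X}
    (hb : b ∈ eliminationSpan R x k) : ⁅FreeLieAlgebra.of R x, b⁆ ∈ eliminationSpan R x k := by
  by_cases hk : k = 0
  · subst hk
    rw [eliminationSpan_zero] at hb ⊢
    obtain ⟨c, rfl⟩ := Submodule.mem_span_singleton.mp hb
    simp
  · rw [eliminationSpan_of_ne_zero x hk] at hb ⊢
    obtain ⟨b, hb, rfl⟩ := hb
    induction hb using Submodule.span_induction with
    | mem b hb =>
      obtain ⟨m, rfl, rfl⟩ := hb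
      exact lie_of_substitute_monomial x m
    | zero => simp
    | add a b _ _ ha hb => rw [map_add, lie_add]; exact add_mem ha hb
    | smul c a _ ha => rw [map_smul, lie_smul]; exact Submodule.smul_mem _ c ha

theorem lie_mem_eliminationSpan (x : X) {j k : ℕ} {a b : FreeLieAlgebra R X}
    (ha : a ∈ eliminationSpan R x j) (hb : b ∈ eliminationSpan R x k) :
    ⁅a, b⁆ ∈ eliminationSpan R x (j + k) := by
  by_cases hj : j = 0
  · subst hj
    rw [eliminationSpan_zero] at ha
    obtain ⟨c, rfl⟩ := Submodule.mem_span_singleton.mp ha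
    rw [smul_lie, zero_add]
    exact Submodule.smul_mem _ c (lie_of_mem_eliminationSpan x hb)
  by_cases hk : k = 0
  · subst hk
    rw [eliminationSpan_zero] at hb
    obtain ⟨c, rfl⟩ := Submodule.mem_span_singleton.mp hb
    rw [lie_smul, add_zero, ← lie_skew]
    exact Submodule.smul_mem _ c (neg_mem (lie_of_mem_eliminationSpan x ha))
  · rw [eliminationSpan_of_ne_zero x (by omega)] at ha hb ⊢
    obtain ⟨a, ha, rfl⟩ := ha
    obtain ⟨b, hb, rfl⟩ := hb
    exact ⟨⁅a, b⁆, lie_mem_lengthSpan ha hb, LieHom.map_lie _ _ _⟩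

theorem monomial_mem_eliminationSpan [DecidableEq X] (x : X) (m : FreeMagma X) :
    monomial R m ∈ eliminationSpan R x ((content m).countP (· ≠ x)) := by
  induction m with
  | ih1 y =>
    by_cases hy : y = x
    · subst hy
      have : (content (FreeMagma.of y)).countP (· ≠ y) = 0 := by
        simp [content, Multiset.countP_eq_zero]
      rw [this, eliminationSpan_zero]
      exact Submodule.mem_span_singleton_self _
    · have : (content (FreeMagma.of y)).countP (· ≠ x) = 1 := by
        rw [content, ← Multiset.cons_zero, Multiset.countP_cons_of_pos (p := (· ≠ x)) 0 hy,
          Multiset.countP_zero]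
      rw [this, eliminationSpan_of_ne_zero x one_ne_zero]
      refine ⟨_, monomial_mem_lengthSpan (FreeMagma.of (0, ⟨y, hy⟩)), ?_⟩
      exact substitute_of x 0 ⟨y, hy⟩
  | ih2 a b ha hb =>
    rw [monomial_mul, content_mul, Multiset.countP_add]
    exact lie_mem_eliminationSpan x ha hb

/-- The derivation of the free associative algebra with `(n, y) ↦ (n + 1, y)`, as the second
component of a homomorphism to the dual numbers. -/
def shiftHom (R : Type u) [CommRing R] (x : X) :
    FreeAlgebra R (Eliminated x) →ₐ[R] DualNumber (FreeAlgebra R (Eliminated x)) :=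
  FreeAlgebra.lift R fun z =>
    TrivSqZeroExt.inl (FreeAlgebra.ι R z) + TrivSqZeroExt.inr (FreeAlgebra.ι R (z.1 + 1, z.2))

theorem fst_shiftHom (x : X) (t : FreeAlgebra R (Eliminated x)) :
    (shiftHom R x t).fst = t := by
  have : (TrivSqZeroExt.fstHom R (FreeAlgebra R (Eliminated x)) _).comp (shiftHom R x) =
      AlgHom.id R (FreeAlgebra R (Eliminated x)) := by
    ext z
    simp [shiftHom]
  exact DFunLike.congr_fun this t

/-- The derivation of the free associative algebra with `(n, y) ↦ (n + 1, y)`. -/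
def shift (R : Type u) [CommRing R] (x : X) : Module.End R (FreeAlgebra R (Eliminated x)) :=
  (TrivSqZeroExt.sndHom _ _).restrictScalars R ∘ₗ (shiftHom R x).toLinearMap

theorem shift_ι (x : X) (n : ℕ) (y : {y : X // y ≠ x}) :
    shift R x (FreeAlgebra.ι R (n, y)) = FreeAlgebra.ι R (n + 1, y) := by
  simp [shift, shiftHom]

theorem shift_mul (x : X) (s t : FreeAlgebra R (Eliminated x)) :
    shift R x (s * t) = s * shift R x t + shift R x s * t := by
  simp [shift, fst_shiftHom]

/-- The action of the free associative algebra on `X` on the one on the eliminated letters, in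
which `x` acts as the derivation `shift` and the other letters by left multiplication. -/
def eliminationAction (R : Type u) [CommRing R] [DecidableEq X] (x : X) :
    FreeAlgebra R X →ₐ[R] Module.End R (FreeAlgebra R (Eliminated x)) :=
  FreeAlgebra.lift R fun y =>
    if h : y = x then shift R x else LinearMap.mulLeft R (FreeAlgebra.ι R (0, ⟨y, h⟩))

/-- The commutator of a derivation `δ` with left multiplication by `t` is left multiplication by `δ
t`, so `ad(x)ⁿ y` acts as the letter `(n, y)`. Evaluation at `1` then recovers the image of `b`, so
injectivity passes from the eliminated letters to `X`. -/
theorem eliminationAction_substitute [DecidableEq X] (x : X)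
    (b : FreeLieAlgebra R (Eliminated x)) :
    eliminationAction R x (toFreeAlgebra R X (substitute R x b)) =
      LinearMap.mulLeft R (toFreeAlgebra R (Eliminated x) b) := by
  have h : ((eliminationAction R x).toLieHom.comp (toFreeAlgebra R X)).comp (substitute R x) =
      (Algebra.lmul R (FreeAlgebra R (Eliminated x))).toLieHom.comp (toFreeAlgebra R _) := by
    ext ⟨n, y⟩ : 1
    induction n with
    | zero =>
      simp [substitute_of, eliminationAction, y.2]
      rfl
    | succ n ih =>
      rw [LieHom.comp_apply, ← lie_substitute_of, LieHom.map_lie]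
      rw [LieHom.comp_apply] at ih
      rw [ih]
      refine LinearMap.ext fun t => ?_
      simp [eliminationAction, LieRing.of_associative_ring_bracket, shift_mul, shift_ι]
  exact DFunLike.congr_fun h b

/-- `multidegree` separates the contents, so each multihomogeneous part of a kernel element is
itself in the kernel. -/
theorem eq_zero_of_multihomogeneous {P : Multiset X → Prop}
    (hP : ∀ s, P s → s ≠ 0 → ∀ b ∈ Submodule.span R (monomial R '' {m | content m = s}),
      toFreeAlgebra R X b = 0 → b = 0)
    {a : FreeLieAlgebra R X} (ha : a ∈ Submodule.span R (monomial R '' {m | P (content m)}))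
    (h : toFreeAlgebra R X a = 0) : a = 0 := by
  classical
  obtain ⟨l, hl, rfl⟩ := (Finsupp.mem_span_image_iff_linearCombination R).mp ha
  rw [Finsupp.linearCombination_apply, Finsupp.sum] at h ⊢
  rw [← Finset.sum_fiberwise_of_maps_to (fun m hm => Finset.mem_image_of_mem content hm)]
  refine Finset.sum_eq_zero fun s hs => ?_
  obtain ⟨m, hm, rfl⟩ := Finset.mem_image.mp hs
  refine hP _ (hl hm) (content_ne_zero m) _ ?_ ?_
  · refine Submodule.sum_mem _ fun m' hm' => Submodule.smul_mem _ _ ?_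
    exact Submodule.subset_span ⟨m', (Finset.mem_filter.mp hm').2, rfl⟩
  · have h' := congrArg (fun t => (multidegree R X t).coeff (content m)) h
    simp only [map_sum, map_smul, multidegree_monomial, map_zero, AddMonoidAlgebra.smul_single,
      AddMonoidAlgebra.coeff_sum, AddMonoidAlgebra.coeff_single, AddMonoidAlgebra.coeff_zero,
      Finsupp.finsetSum_apply, Finsupp.single_apply, Finsupp.zero_apply] at h'
    rw [map_sum, Finset.sum_filter]
    simpa only [map_smul] using h'

/-- Induction on length for all alphabets at once, since elimination changes the alphabet.
Eliminating a letter `x` that occurs leaves only the other letters to count, so the length drops. -/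
theorem eq_zero_of_mem_lengthSpan (n : ℕ) : ∀ {X : Type v} {a : FreeLieAlgebra R X},
    a ∈ lengthSpan R X n → toFreeAlgebra R X a = 0 → a = 0 := by
  classical
  induction n using Nat.strong_induction_on with
  | _ n ih =>
  intro X a ha h
  refine eq_zero_of_multihomogeneous (P := fun s => s.card = n) ?_ ha h
  · intro s hs hs0 b hb h
    obtain ⟨x, hx⟩ := Multiset.exists_mem_of_ne_zero hs0
    have hb' : b ∈ eliminationSpan R x (s.countP (· ≠ x)) := by
      refine Submodule.span_le.mpr ?_ hb
      rintro _ ⟨m, rfl, rfl⟩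
      exact monomial_mem_eliminationSpan x m
    by_cases hk : s.countP (· ≠ x) = 0
    · rw [hk, eliminationSpan_zero] at hb'
      obtain ⟨c, rfl⟩ := Submodule.mem_span_singleton.mp hb'
      -- Only a multiple of `x` remains; sending every letter to `1` reads off its coefficient.
      have h' := congrArg (FreeAlgebra.lift R fun _ : X => (1 : R)) h
      simp only [map_smul, toFreeAlgebra_of, FreeAlgebra.lift_ι_apply, map_zero, smul_eq_mul,
        mul_one] at h'
      rw [h', zero_smul]
    · rw [eliminationSpan_of_ne_zero x hk] at hb'
      obtain ⟨c, hc, rfl⟩ := hb'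
      have hlt : s.countP (· ≠ x) < n := by
        rw [← hs]
        refine lt_of_le_of_ne (Multiset.countP_le_card _ _) fun h => ?_
        exact Multiset.countP_eq_card.mp h x hx rfl
      have h1 := eliminationAction_substitute x c
      rw [show toFreeAlgebra R X (substitute R x c) = 0 from h, map_zero] at h1
      have h2 := (DFunLike.congr_fun h1 1).symm
      rw [LinearMap.mulLeft_apply, mul_one, LinearMap.zero_apply] at h2
      rw [ih _ hlt hc h2, map_zero]

theorem toFreeAlgebra_injective (X : Type v) : Function.Injective (toFreeAlgebra R X) := by
  refine (injective_iff_map_eq_zero _).mpr fun a h => ?_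
  refine eq_zero_of_multihomogeneous (P := fun _ => True) ?_ ?_ h
  · intro s _ _ b hb h
    refine eq_zero_of_mem_lengthSpan s.card (Submodule.span_mono ?_ hb) h
    rintro _ ⟨m, rfl, rfl⟩
    exact ⟨m, rfl, rfl⟩
  · rw [Set.ofPred_true, Set.image_univ, span_range_monomial]
    trivial

end Embedding

/-! ### Dimension shifting for `Ext²`. -/

section Ext

variable {A : Type w} [Ring A] {M N P : Type w} [AddCommGroup M] [Module A M] [AddCommGroup N]
  [Module A N] [AddCommGroup P] [Module A P]

theorem subsingleton_ext_two_of_projective_ker [Module.Projective A M] {f : M →ₗ[A] N}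
    (hf : Function.Surjective f) [Module.Projective A (LinearMap.ker f)] (T : ModuleCat.{w} A) :
    Subsingleton (Abelian.Ext (ModuleCat.of A N) T 2) := by
  have hS := LinearMap.shortExact_shortComplexKer hf
  have : Projective f.shortComplexKer.X₂ :=
    (IsProjective.iff_projective M).mp inferInstance
  have : Projective f.shortComplexKer.X₁ :=
    (IsProjective.iff_projective (LinearMap.ker f)).mp inferInstance
  refine subsingleton_of_forall_eq 0 fun x => ?_
  obtain ⟨y, rfl⟩ := precomp_extClass_surjective_of_projective_X₂ T hS 1 x
  rw [Abelian.Ext.eq_zero_of_projective y, map_zero]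

/-- The obstruction to extending `φ` is a class in `Ext¹(ker f, T)`, which injects into `Ext²(N, T)
= 0` because `M` is projective. -/
theorem exists_extension_of_subsingleton_ext_two [Module.Projective A M] [Module.Projective A P]
    {f : M →ₗ[A] N} (hf : Function.Surjective f) {g : P →ₗ[A] LinearMap.ker f}
    (hg : Function.Surjective g) {T : ModuleCat.{w} A}
    (h : Subsingleton (Abelian.Ext (ModuleCat.of A N) T 2)) (φ : LinearMap.ker g →ₗ[A] T) :
    ∃ ψ : P →ₗ[A] T, ψ ∘ₗ (LinearMap.ker g).subtype = φ := by
  have hS := LinearMap.shortExact_shortComplexKer hf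
  have hS' := LinearMap.shortExact_shortComplexKer hg
  have : Projective f.shortComplexKer.X₂ :=
    (IsProjective.iff_projective M).mp inferInstance
  have h1 : hS'.extClass.comp (Abelian.Ext.mk₀ (ModuleCat.ofHom φ)) (add_zero 1) = 0 := by
    obtain ⟨y, hy⟩ := Abelian.Ext.contravariant_sequence_exact₁ hS T
      (hS'.extClass.comp (Abelian.Ext.mk₀ (ModuleCat.ofHom φ)) (add_zero 1)) (n₁ := 2) rfl
      (Subsingleton.elim _ _)
    rw [← hy, Abelian.Ext.eq_zero_of_projective y, Abelian.Ext.comp_zero]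
  obtain ⟨y, hy⟩ := Abelian.Ext.contravariant_sequence_exact₁ hS' T _ _ h1
  obtain ⟨ψ, rfl⟩ := (Abelian.Ext.mk₀_bijective _ _).surjective y
  rw [Abelian.Ext.mk₀_comp_mk₀] at hy
  refine ⟨ψ.hom, ?_⟩
  exact congrArg ModuleCat.Hom.hom ((Abelian.Ext.mk₀_bijective _ _).injective hy)

end Ext

/-! ### The enveloping algebra and its augmentation ideal. -/

section Enveloping

variable {F : Type u} [Field F] {L : Type v} [LieRing L] [LieAlgebra F L]

local notation "U" => UniversalEnvelopingAlgebra F L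

local notation "ι" => UniversalEnvelopingAlgebra.ι F

@[simp]
theorem augmentation_ι (x : L) : augmentation F L (ι x) = 0 :=
  UniversalEnvelopingAlgebra.lift_ι_apply _ _ _

/-- By the universal property, the identity of `U` factors through the inclusion of the generated
subalgebra. -/
theorem adjoin_image_ι {S : Set L} (hS : LieSubalgebra.lieSpan F L S = ⊤) :
    Algebra.adjoin F (ι '' S) = (⊤ : Subalgebra F U) := by
  set A : Subalgebra F U := Algebra.adjoin F (ι '' S)
  let A' : LieSubalgebra F L :=
    { A.toSubmodule.comap ((ι : L →ₗ⁅F⁆ U) : L →ₗ[F] U) with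
      lie_mem' := fun {x y} (hx : ι x ∈ A) (hy : ι y ∈ A) => by
        change ι ⁅x, y⁆ ∈ A
        rw [LieHom.map_lie, LieRing.of_associative_ring_bracket]
        exact sub_mem (mul_mem hx hy) (mul_mem hy hx) }
  have hA : ∀ x, ι x ∈ A := by
    have : (⊤ : LieSubalgebra F L) ≤ A' := by
      rw [← hS, LieSubalgebra.lieSpan_le]
      exact fun x hx => Algebra.subset_adjoin ⟨x, hx, rfl⟩
    exact fun x => this (show x ∈ (⊤ : LieSubalgebra F L) from trivial)
  let j : L →ₗ⁅F⁆ A :=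
    { ((ι : L →ₗ⁅F⁆ U) : L →ₗ[F] U).codRestrict A.toSubmodule hA with
      map_lie' := fun {x y} => Subtype.ext (LieHom.map_lie (ι) x y) }
  have h : A.val.comp (UniversalEnvelopingAlgebra.lift F j) = AlgHom.id F U := by
    refine UniversalEnvelopingAlgebra.hom_ext (R := F) (L := L) (LieHom.ext fun x => ?_)
    change ((UniversalEnvelopingAlgebra.lift F j (ι x) : A) : U) = ι x
    rw [UniversalEnvelopingAlgebra.lift_ι_apply]
    rfl
  refine eq_top_iff.mpr fun a _ => ?_
  rw [← show A.val (UniversalEnvelopingAlgebra.lift F j a) = a from DFunLike.congr_fun h a]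
  exact Subtype.property _

theorem enveloping_induction {S : Set L} (hS : LieSubalgebra.lieSpan F L S = ⊤) {p : U → Prop}
    (hι : ∀ x ∈ S, p (ι x)) (halg : ∀ c : F, p (algebraMap F U c))
    (hadd : ∀ a b, p a → p b → p (a + b)) (hmul : ∀ a b, p a → p b → p (a * b)) (a : U) : p a := by
  have ha : a ∈ Algebra.adjoin F (ι '' S) := by rw [adjoin_image_ι hS]; trivial
  induction ha using Algebra.adjoin_induction with
  | mem x hx => obtain ⟨x, hx, rfl⟩ := hx; exact hι x hx
  | algebraMap c => exact halg c
  | add a b _ _ ha hb => exact hadd a b ha hb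
  | mul a b _ _ ha hb => exact hmul a b ha hb

variable (F L) in
/-- The augmentation as a homomorphism of `U(L)`-modules. -/
def augmentationLinear : U →ₗ[U] trivialModule F L where
  toFun a := (ULift.up (augmentation F L a) : ULift.{v} F)
  map_add' a b := congrArg ULift.up (map_add _ a b)
  map_smul' a b := congrArg ULift.up (map_mul _ a b)

theorem augmentationLinear_surjective : Function.Surjective (augmentationLinear F L) :=
  fun c => ⟨algebraMap F U (ULift.down (show ULift.{v} F from c)),
    congrArg ULift.up ((augmentation F L).commutes _)⟩

theorem mem_ker_augmentationLinear {a : U} :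
    a ∈ LinearMap.ker (augmentationLinear F L) ↔ augmentation F L a = 0 := by
  rw [LinearMap.mem_ker]
  exact ⟨fun h => congrArg ULift.down h, fun h => congrArg ULift.up h⟩

/-- The homomorphism of left modules `(aᵢ) ↦ ∑ aᵢ xᵢ` to the augmentation ideal. -/
def toAugmentationIdeal {B : Type*} (x : B → L) :
    (B →₀ U) →ₗ[U] LinearMap.ker (augmentationLinear F L) :=
  (Finsupp.linearCombination U fun b => ι (x b)).codRestrict _ fun f => by
    rw [mem_ker_augmentationLinear, Finsupp.linearCombination_apply, Finsupp.sum, map_sum]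
    exact Finset.sum_eq_zero fun b _ => by rw [smul_eq_mul, map_mul, augmentation_ι, mul_zero]

theorem coe_toAugmentationIdeal {B : Type*} (x : B → L) (f : B →₀ U) :
    (toAugmentationIdeal x f : U) = Finsupp.linearCombination U (fun b => ι (x b)) f :=
  rfl

theorem toAugmentationIdeal_surjective {B : Type*} {x : B → L}
    (hx : LieSubalgebra.lieSpan F L (Set.range x) = ⊤) :
    Function.Surjective (toAugmentationIdeal (F := F) x) := by
  have key : ∀ a : U, a - algebraMap F U (augmentation F L a) ∈
      LinearMap.range (Finsupp.linearCombination U fun b => ι (x b)) := by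
    refine enveloping_induction hx ?_ ?_ ?_ ?_
    · rintro _ ⟨b, rfl⟩
      rw [augmentation_ι, map_zero, sub_zero]
      exact ⟨Finsupp.single b 1, by simp⟩
    · intro c
      rw [AlgHom.commutes, Algebra.algebraMap_self_apply, sub_self]
      exact zero_mem _
    · intro a b ha hb
      rw [map_add, map_add, add_sub_add_comm]
      exact add_mem ha hb
    · intro a b ha hb
      have : a * b - algebraMap F U (augmentation F L (a * b)) =
          a • (b - algebraMap F U (augmentation F L b)) +
            algebraMap F U (augmentation F L b) •
              (a - algebraMap F U (augmentation F L a)) := by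
        rw [map_mul, map_mul, smul_eq_mul, smul_eq_mul, mul_sub, mul_sub,
          Algebra.commutes (augmentation F L b) a,
          Algebra.commutes (augmentation F L b) (algebraMap F U _)]
        abel
      rw [this]
      exact add_mem (Submodule.smul_mem _ _ hb) (Submodule.smul_mem _ _ ha)
  rintro ⟨a, ha⟩
  obtain ⟨f, hf⟩ := key a
  rw [mem_ker_augmentationLinear.mp ha, map_zero, sub_zero] at hf
  exact ⟨f, Subtype.ext hf⟩

/-- A linear form on `L` that vanishes on brackets gives a derivation `U(L) → F`. -/
theorem exists_derivation_of_lie_eq_zero (χ : L →ₗ[F] F) (hχ : ∀ x y : L, χ ⁅x, y⁆ = 0) :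
    ∃ d : U →ₗ[F] F, ∀ a x, d (a * ι x) = augmentation F L a * χ x := by
  -- Dual numbers commute, so `x ↦ χ(x)ε` is a Lie homomorphism exactly because `χ` kills brackets;
  -- the second component of its extension to `U` is the derivation.
  let j : L →ₗ⁅F⁆ DualNumber F :=
    { (TrivSqZeroExt.inrHom F F) ∘ₗ χ with
      map_lie' := fun {x y} => by
        simp [hχ, LieRing.of_associative_ring_bracket] }
  have hj : ∀ x, UniversalEnvelopingAlgebra.lift F j (ι x) = TrivSqZeroExt.inr (χ x) :=
    UniversalEnvelopingAlgebra.lift_ι_apply F j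
  have hfst : ∀ a, (UniversalEnvelopingAlgebra.lift F j a).fst = augmentation F L a := by
    have : (TrivSqZeroExt.fstHom F F F).comp (UniversalEnvelopingAlgebra.lift F j) =
        augmentation F L := by
      refine UniversalEnvelopingAlgebra.hom_ext (R := F) (L := L) (LieHom.ext fun x => ?_)
      change (UniversalEnvelopingAlgebra.lift F j (ι x)).fst = augmentation F L (ι x)
      rw [hj, augmentation_ι, TrivSqZeroExt.fst_inr]
    exact DFunLike.congr_fun this
  refine ⟨TrivSqZeroExt.sndHom F F ∘ₗ (UniversalEnvelopingAlgebra.lift F j).toLinearMap, ?_⟩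
  intro a x
  change (UniversalEnvelopingAlgebra.lift F j (a * ι x)).snd = _
  rw [map_mul, hj, TrivSqZeroExt.snd_mul, hfst]
  simp

/-! ### The grading, Nakayama's lemma and freeness of the augmentation ideal. -/

section GradedEnveloping

variable (ℒ : ℕ → Submodule F L) [GradedLieAlgebra ℒ]

theorem decompose_lie_one_eq_zero (h0 : ℒ 0 = ⊥) (x y : L) :
    (DirectSum.decompose ℒ ⁅x, y⁆ 1 : L) = 0 := by
  induction x using DirectSum.Decomposition.inductionOn ℒ with
  | zero => simp
  | add a b ha hb =>
    rw [add_lie, DirectSum.decompose_add, DirectSum.add_apply, Submodule.coe_add, ha, hb, add_zero]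
  | @homogeneous i x =>
    induction y using DirectSum.Decomposition.inductionOn ℒ with
    | zero => simp
    | add a b ha hb =>
      rw [lie_add, DirectSum.decompose_add, DirectSum.add_apply, Submodule.coe_add, ha, hb,
        add_zero]
    | @homogeneous j y =>
      have hm : ⁅(x : L), (y : L)⁆ ∈ ℒ (i + j) := SetLike.GradedBracket.bracket_mem x.2 y.2
      by_cases hij : i + j = 1
      · have hz : ∀ z : ℒ 0, (z : L) = 0 := fun z => (Submodule.mem_bot F).mp (h0 ▸ z.2)
        obtain ⟨rfl, rfl⟩ | ⟨rfl, rfl⟩ : (i = 0 ∧ j = 1) ∨ (i = 1 ∧ j = 0) := by omega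
        · simp [hz x]
        · simp [hz y]
      · exact DirectSum.decompose_of_mem_ne ℒ hm hij

/-- The linear map `L → U(L)[t]` that sends `x` of degree `i` to `x tⁱ`. -/
def degreeLinear : L →ₗ[F] Polynomial U :=
  DirectSum.toModule F ℕ (Polynomial U) (fun i =>
    (Polynomial.monomial i).restrictScalars F ∘ₗ ((ι : L →ₗ⁅F⁆ U) : L →ₗ[F] U) ∘ₗ
      (ℒ i).subtype) ∘ₗ (DirectSum.decomposeLinearEquiv ℒ : L →ₗ[F] _)

theorem degreeLinear_of_mem {i : ℕ} {x : L} (hx : x ∈ ℒ i) :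
    degreeLinear ℒ x = Polynomial.monomial i (ι x : U) := by
  simp only [degreeLinear, LinearMap.comp_apply, LinearEquiv.coe_coe,
    DirectSum.decomposeLinearEquiv_apply, DirectSum.decompose_of_mem ℒ hx]
  exact DirectSum.toModule_lof F i _

/-- The homomorphism `L → U(L)[t]` that sends `x` of degree `i` to `x tⁱ`. -/
def degreeLie : L →ₗ⁅F⁆ Polynomial U :=
  { degreeLinear ℒ with
    map_lie' := fun {x y} => by
      change degreeLinear ℒ ⁅x, y⁆ = ⁅degreeLinear ℒ x, degreeLinear ℒ y⁆
      induction x using DirectSum.Decomposition.inductionOn ℒ with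
      | zero => simp
      | add a b ha hb => simp [ha, hb]
      | @homogeneous i x =>
        induction y using DirectSum.Decomposition.inductionOn ℒ with
        | zero => simp
        | add a b ha hb => simp [ha, hb]
        | @homogeneous j y =>
          rw [degreeLinear_of_mem ℒ (SetLike.GradedBracket.bracket_mem x.2 y.2),
            degreeLinear_of_mem ℒ x.2, degreeLinear_of_mem ℒ y.2, LieHom.map_lie,
            LieRing.of_associative_ring_bracket, LieRing.of_associative_ring_bracket,
            Polynomial.monomial_mul_monomial, Polynomial.monomial_mul_monomial, add_comm j i,
            map_sub] }

/-- The homomorphism `U(L) → U(L)[t]` that records the degree. -/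
def degreeHom : U →ₐ[F] Polynomial U :=
  UniversalEnvelopingAlgebra.lift F (degreeLie ℒ)

theorem degreeHom_ι {x : L} (hx : x ∈ ℒ 1) :
    degreeHom ℒ (ι x) = Polynomial.monomial 1 (ι x : U) :=
  (UniversalEnvelopingAlgebra.lift_ι_apply F _ x).trans (degreeLinear_of_mem ℒ hx)

variable {ℒ}

/-- Setting `t = 1` shows that an element without nonzero homogeneous components is zero. -/
theorem eval_one_degreeHom (h1 : IsOneGenerated ℒ) (a : U) : (degreeHom ℒ a).eval 1 = a := by
  induction a using enveloping_induction h1 with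
  | hι x hx => rw [degreeHom_ι ℒ hx, Polynomial.eval_monomial, one_pow, mul_one]
  | halg c => rw [AlgHom.commutes, Polynomial.algebraMap_apply, Polynomial.eval_C]
  | hadd a b ha hb => rw [map_add, Polynomial.eval_add, ha, hb]
  | hmul a b ha hb =>
    rw [map_mul, Polynomial.eval,
      Polynomial.eval₂_mul_noncomm _ _ fun k => Commute.one_right _]
    exact congrArg₂ (· * ·) ha hb

theorem coeff_zero_degreeHom (h1 : IsOneGenerated ℒ) (a : U) :
    (degreeHom ℒ a).coeff 0 = algebraMap F U (augmentation F L a) := by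
  induction a using enveloping_induction h1 with
  | hι x hx => rw [degreeHom_ι ℒ hx, Polynomial.coeff_monomial_of_ne _ zero_ne_one, augmentation_ι,
      map_zero]
  | halg c => simp [Polynomial.algebraMap_apply]
  | hadd a b ha hb => rw [map_add, Polynomial.coeff_add, ha, hb, map_add, map_add]
  | hmul a b ha hb => rw [map_mul, Polynomial.mul_coeff_zero, ha, hb, map_mul, map_mul]

variable {B : Type w}

/-- A graded form of Nakayama's lemma. -/
theorem eq_bot_of_le_span_augmentation_smul (h1 : IsOneGenerated ℒ)
    {K : Submodule U (B →₀ U)}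
    (hK : (K : Set (B →₀ U)) ⊆
      Submodule.span F {f | ∃ a : U, ∃ k ∈ K, augmentation F L a = 0 ∧ f = a • k}) : K = ⊥ := by
  -- `K` need not be graded: if all of `K` vanishes below degree `n`, then `IK` vanishes below
  -- degree `n + 1`, since `I` has no part of degree 0.
  have key : ∀ n : ℕ, ∀ k ∈ K, ∀ i, ∀ m < n, (degreeHom ℒ (k i)).coeff m = 0 := by
    intro n
    induction n with
    | zero => simp
    | succ n ih =>
      intro k hk' i
      have hk := hK hk'
      clear hk'
      induction hk using Submodule.span_induction with
      | mem f hf =>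
        obtain ⟨a, k, hk, ha, rfl⟩ := hf
        intro m hm
        rw [Finsupp.smul_apply, smul_eq_mul, map_mul, Polynomial.coeff_mul]
        refine Finset.sum_eq_zero fun p hp => ?_
        have hp := Finset.HasAntidiagonal.mem_antidiagonal.mp hp
        by_cases h : p.1 = 0
        · rw [h, coeff_zero_degreeHom h1, ha, map_zero, zero_mul]
        · rw [ih k hk i p.2 (by omega), mul_zero]
      | zero => simp
      | add f g _ _ hf hg =>
        intro m hm
        rw [Finsupp.add_apply, map_add, Polynomial.coeff_add, hf m hm, hg m hm, add_zero]
      | smul c f _ hf =>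
        intro m hm
        rw [Finsupp.smul_apply, map_smul, Polynomial.coeff_smul, hf m hm, smul_zero]
  refine (Submodule.eq_bot_iff K).mpr fun k hk => Finsupp.ext fun i => ?_
  rw [← eval_one_degreeHom h1 (k i)]
  have : degreeHom ℒ (k i) = 0 := Polynomial.ext fun m => key (m + 1) k hk i m (Nat.lt_succ_self m)
  rw [this, Polynomial.eval_zero, Finsupp.zero_apply]

theorem smul_trivialModule_eq_zero {a : U} (ha : augmentation F L a = 0) (c : trivialModule F L) :
    a • c = 0 := by
  change ULift.up (augmentation F L a * ULift.down (show ULift.{v} F from c)) = 0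
  rw [ha, zero_mul]
  rfl

theorem toAugmentationIdeal_injective (h0 : ℒ 0 = ⊥) (h1 : IsOneGenerated ℒ) {B : Type v}
    (b : Module.Basis B F (ℒ 1)) (hH : Subsingleton (Cohomology F L 2)) :
    Function.Injective (toAugmentationIdeal (F := F) fun i => (b i : L)) := by
  set g := toAugmentationIdeal (F := F) fun i => (b i : L)
  have hgen : LieSubalgebra.lieSpan F L (Set.range fun i => (b i : L)) = ⊤ := by
    set S := LieSubalgebra.lieSpan F L (Set.range fun i => (b i : L))
    have hS : (⊤ : Submodule F (ℒ 1)) ≤ S.toSubmodule.comap (ℒ 1).subtype := by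
      rw [← b.span_eq, Submodule.span_le]
      rintro _ ⟨i, rfl⟩
      exact LieSubalgebra.subset_lieSpan ⟨i, rfl⟩
    rw [eq_top_iff, ← show LieSubalgebra.lieSpan F L (ℒ 1 : Set L) = ⊤ from h1,
      LieSubalgebra.lieSpan_le]
    exact fun y hy => hS (show (⟨y, hy⟩ : ℒ 1) ∈ ⊤ from trivial)
  -- `K ⊆ I^(B)`: the derivation attached to the `i`-th coordinate of the degree 1 part sends the
  -- relation `∑ kⱼ bⱼ = 0` to `ε(kᵢ) = 0`.
  have hε : ∀ k ∈ LinearMap.ker g, ∀ i, augmentation F L (k i) = 0 := by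
    classical
    intro k hk i
    let χ : L →ₗ[F] F := b.coord i ∘ₗ
      DirectSum.component F ℕ (fun i => ℒ i) 1 ∘ₗ (DirectSum.decomposeLinearEquiv ℒ : L →ₗ[F] _)
    have hχ : ∀ x, χ x = b.coord i (DirectSum.decompose ℒ x 1) := fun x => rfl
    obtain ⟨d, hd⟩ := exists_derivation_of_lie_eq_zero χ fun x y => by
      rw [hχ, Subtype.ext (a2 := (0 : ℒ 1)) (decompose_lie_one_eq_zero ℒ h0 x y), map_zero]
    have h := congrArg d (congrArg Subtype.val (LinearMap.mem_ker.mp hk))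
    rw [coe_toAugmentationIdeal, Finsupp.linearCombination_apply, Finsupp.sum, map_sum] at h
    have hb : ∀ j, χ (b j) = if j = i then 1 else 0 := by
      intro j
      rw [hχ, DirectSum.decompose_coe, DirectSum.of_eq_same, Module.Basis.coord_apply,
        Module.Basis.repr_self, Finsupp.single_apply]
    by_contra hne
    have h' : k i ≠ 0 → augmentation F L (k i) = 0 := by
      simpa [hd, hb, -UniversalEnvelopingAlgebra.ι_apply] using h
    exact hne (h' fun hki => hne (by rw [hki, map_zero]))
  -- Each `φ` extends to `U^(B)`, and the extension kills `I^(B) ⊇ K`.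
  have hφ : ∀ φ : LinearMap.ker g →ₗ[U] trivialModule F L, φ = 0 := by
    intro φ
    obtain ⟨ψ, rfl⟩ := exists_extension_of_subsingleton_ext_two
      augmentationLinear_surjective (toAugmentationIdeal_surjective hgen) hH φ
    ext ⟨k, hk⟩
    change ψ k = 0
    rw [← Finsupp.sum_single k, Finsupp.sum, map_sum]
    refine Finset.sum_eq_zero fun i _ => ?_
    rw [← mul_one (k i), ← smul_eq_mul, ← Finsupp.smul_single, map_smul]
    exact smul_trivialModule_eq_zero (hε k hk i) _
  refine LinearMap.ker_eq_bot.mp (eq_bot_of_le_span_augmentation_smul h1 ?_)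
  intro k hk
  by_contra hkN
  -- An `F`-linear form that kills `IK` but not `k` is automatically `U`-linear on `K`, as `a -
  -- ε(a)` lies in `I`.
  obtain ⟨f, hfk, hf⟩ := Submodule.exists_le_ker_of_notMem hkN
  let φ : LinearMap.ker g →ₗ[U] trivialModule F L :=
    { toFun := fun k => (ULift.up (f k) : ULift.{v} F)
      map_add' := fun k l => congrArg ULift.up (map_add f _ _)
      map_smul' := fun a k => by
        have h : f ((a - algebraMap F U (augmentation F L a)) • (k : B →₀ U)) = 0 :=
          hf (Submodule.subset_span ⟨_, k, k.2, by simp, rfl⟩)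
        rw [sub_smul, map_sub, algebraMap_smul, map_smul f (augmentation F L a) (k : B →₀ U),
          sub_eq_zero] at h
        exact congrArg ULift.up h }
  exact hfk (congrArg ULift.down (DFunLike.congr_fun (hφ φ) ⟨k, hk⟩))

end GradedEnveloping

end Enveloping

/-! ### Free associative subalgebras. -/

section FreeAlgebra

variable {F : Type u} [Field F] {B : Type v}

variable (F B) in
/-- The span of the words of length less than `n`. -/
def wordSpan : ℕ → Submodule F (FreeAlgebra F B)
  | 0 => ⊥
  | n + 1 => LinearMap.range (Algebra.linearMap F (FreeAlgebra F B)) ⊔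
      ⨆ b, (wordSpan n).map (LinearMap.mulRight F (FreeAlgebra.ι F b))

theorem wordSpan_mono : Monotone (wordSpan F B) := by
  refine monotone_nat_of_le_succ fun n => ?_
  induction n with
  | zero => exact bot_le
  | succ n ih => exact sup_le_sup_left (iSup_mono fun b => Submodule.map_mono ih) _

theorem exists_mem_wordSpan (t : FreeAlgebra F B) : ∃ n, t ∈ wordSpan F B n := by
  have key : ∀ s t : FreeAlgebra F B, (∃ n, t ∈ wordSpan F B n) →
      ∃ n, t * s ∈ wordSpan F B n := by
    intro s
    induction s using FreeAlgebra.induction with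
    | grade0 c =>
      rintro t ⟨n, ht⟩
      refine ⟨n, ?_⟩
      rw [← Algebra.commutes, ← Algebra.smul_def]
      exact Submodule.smul_mem _ c ht
    | grade1 b =>
      rintro t ⟨n, ht⟩
      exact ⟨n + 1, Submodule.mem_sup_right (Submodule.mem_iSup_of_mem b ⟨t, ht, rfl⟩)⟩
    | mul a b ha hb =>
      intro t ht
      rw [← mul_assoc]
      exact hb _ (ha _ ht)
    | add a b ha hb =>
      intro t ht
      obtain ⟨n, hn⟩ := ha t ht
      obtain ⟨m, hm⟩ := hb t ht
      rw [mul_add]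
      exact ⟨max n m, add_mem (wordSpan_mono (le_max_left n m) hn)
        (wordSpan_mono (le_max_right n m) hm)⟩
  have := key t 1 ⟨1, Submodule.mem_sup_left ⟨1, map_one (algebraMap F _)⟩⟩
  rwa [one_mul] at this

/-- Split `t = c + ∑ r_b b` by last letters. If `t` maps to zero, `ε` gives `c = 0`, independence of
the `x b` sends each `r_b` to zero, and the `r_b` involve shorter words. -/
theorem lift_injective_of_linearCombination_injective {A : Type w} [Ring A] [Algebra F A]
    {x : B → A} (ε : A →ₐ[F] F) (hε : ∀ b, ε (x b) = 0)
    (hx : Function.Injective (Finsupp.linearCombination A x)) :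
    Function.Injective (FreeAlgebra.lift F x) := by
  have key : ∀ n, ∀ t ∈ wordSpan F B n, FreeAlgebra.lift F x t = 0 → t = 0 := by
    intro n
    induction n with
    | zero => exact fun t ht _ => ht
    | succ n ih =>
      intro t ht h
      obtain ⟨_, ⟨c, rfl⟩, s, hs, rfl⟩ := Submodule.mem_sup.mp ht
      obtain ⟨f, hf, rfl⟩ := (Submodule.mem_iSup_iff_exists_finsupp _ _).mp hs
      choose r hr hrf using hf
      have hlift : FreeAlgebra.lift F x (f.sum fun _ y => y) = Finsupp.linearCombination A x
          (∑ b ∈ f.support, Finsupp.single b (FreeAlgebra.lift F x (r b))) := by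
        rw [Finsupp.sum, map_sum, map_sum]
        refine Finset.sum_congr rfl fun b _ => ?_
        rw [← hrf b, LinearMap.mulRight_apply, map_mul, FreeAlgebra.lift_ι_apply,
          Finsupp.linearCombination_single, smul_eq_mul]
      have hc : c = 0 := by
        have := congrArg ε h
        rw [map_add, hlift, Finsupp.linearCombination_apply, Finsupp.sum, map_add, map_sum,
          Finset.sum_eq_zero fun b _ => by rw [smul_eq_mul, map_mul, hε, mul_zero]] at this
        simpa using this
      rw [hc, map_zero, zero_add] at h ⊢
      rw [hlift] at h
      have hr0 := (injective_iff_map_eq_zero _).mp hx _ h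
      refine Finset.sum_eq_zero fun b hb => ?_
      have hb' := DFunLike.congr_fun hr0 b
      rw [Finsupp.finsetSum_apply, Finset.sum_eq_single_of_mem b hb
        fun i _ hi => Finsupp.single_eq_of_ne hi.symm, Finsupp.single_eq_same] at hb'
      rw [← hrf b, ih _ (hr b) hb', map_zero]
  refine (injective_iff_map_eq_zero _).mpr fun t ht => ?_
  obtain ⟨n, hn⟩ := exists_mem_wordSpan t
  exact key n t hn ht

end FreeAlgebra

/-! ### Cohomology of free Lie algebras. -/

section Free

variable {F : Type u} [Field F] {L : Type v} [LieRing L] [LieAlgebra F L]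

local notation "U" => UniversalEnvelopingAlgebra F L

local notation "ι" => UniversalEnvelopingAlgebra.ι F

variable {X : Type w}

theorem lieSpan_range_symm_of (e : L ≃ₗ⁅F⁆ FreeLieAlgebra F X) :
    LieSubalgebra.lieSpan F L (Set.range fun x => e.symm (FreeLieAlgebra.of F x)) = ⊤ := by
  set S := LieSubalgebra.lieSpan F L (Set.range fun x => e.symm (FreeLieAlgebra.of F x))
  have h : (⊤ : LieSubalgebra F (FreeLieAlgebra F X)) ≤ S.comap (e.symm : _ →ₗ⁅F⁆ L) := by
    rw [← lieSpan_range_of, LieSubalgebra.lieSpan_le]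
    rintro _ ⟨x, rfl⟩
    exact LieSubalgebra.subset_lieSpan ⟨x, rfl⟩
  refine eq_top_iff.mpr fun a _ => ?_
  have := h (show e a ∈ (⊤ : LieSubalgebra F (FreeLieAlgebra F X)) from trivial)
  change e.symm (e a) ∈ S at this
  rwa [LieEquiv.symm_apply_apply] at this

/-- The action of `U(L)` on `U(L)^(X) × F` whose coefficient `F → U(L)^(X)` is the universal
derivation `U(L) → U(L)^(X)` of the free Lie algebra. -/
def derivationAction (e : L ≃ₗ⁅F⁆ FreeLieAlgebra F X) :
    U →ₐ[F] Module.End F ((X →₀ U) × F) :=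
  UniversalEnvelopingAlgebra.lift F
    -- Freeness enters here: the operators for the letters may be prescribed arbitrarily.
    ((FreeLieAlgebra.lift F fun x =>
      LinearMap.inl F (X →₀ U) F ∘ₗ
        (Module.toModuleEnd F (S := U) (X →₀ U) (ι (e.symm (FreeLieAlgebra.of F x)))).coprod
          (LinearMap.toSpanSingleton F (X →₀ U) (Finsupp.single x 1))).comp (e : L →ₗ⁅F⁆ _))

theorem derivationAction_ι (e : L ≃ₗ⁅F⁆ FreeLieAlgebra F X) (x : X) (w : (X →₀ U) × F) :
    derivationAction e (ι (e.symm (FreeLieAlgebra.of F x))) w =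
      ((ι (e.symm (FreeLieAlgebra.of F x)) : U) • w.1 + w.2 • Finsupp.single x 1, 0) := by
  rw [derivationAction, UniversalEnvelopingAlgebra.lift_ι_apply, LieHom.comp_apply]
  simp [-UniversalEnvelopingAlgebra.ι_apply]

theorem snd_derivationAction (e : L ≃ₗ⁅F⁆ FreeLieAlgebra F X) (a : U) (w : (X →₀ U) × F) :
    (derivationAction e a w).2 = augmentation F L a * w.2 := by
  induction a using enveloping_induction (lieSpan_range_symm_of e) generalizing w with
  | hι y hy =>
    obtain ⟨x, rfl⟩ := hy
    rw [derivationAction_ι, augmentation_ι, zero_mul]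
  | halg c => simp [Algebra.algebraMap_eq_smul_one]
  | hadd a b ha hb => rw [map_add, map_add, LinearMap.add_apply, Prod.snd_add, ha, hb, add_mul]
  | hmul a b ha hb => rw [map_mul, map_mul, Module.End.mul_apply, ha, hb, mul_assoc]

theorem derivationAction_inl (e : L ≃ₗ⁅F⁆ FreeLieAlgebra F X) (a : U) (f : X →₀ U) :
    derivationAction e a (f, 0) = (a • f, 0) := by
  induction a using enveloping_induction (lieSpan_range_symm_of e) generalizing f with
  | hι y hy =>
    obtain ⟨x, rfl⟩ := hy
    rw [derivationAction_ι, zero_smul, add_zero]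
  | halg c => simp [Algebra.algebraMap_eq_smul_one]
  | hadd a b ha hb =>
    rw [map_add, LinearMap.add_apply, ha, hb, Prod.mk_add_mk, add_zero, add_smul]
  | hmul a b ha hb => rw [map_mul, Module.End.mul_apply, hb, ha, mul_smul]

/-- The map `(f, c) ↦ ∑ f_x x + c` is `U`-linear for this action. At `(0, 1)` this is Fox's formula
`a = ∑ (∂a/∂x) x + ε(a)`. -/
theorem linearCombination_derivationAction (e : L ≃ₗ⁅F⁆ FreeLieAlgebra F X)
    (a : U) (w : (X →₀ U) × F) :
    Finsupp.linearCombination U (fun x => (ι (e.symm (FreeLieAlgebra.of F x)) : U))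
        (derivationAction e a w).1 + algebraMap F U (derivationAction e a w).2 =
      a * (Finsupp.linearCombination U (fun x => (ι (e.symm (FreeLieAlgebra.of F x)) : U)) w.1 +
        algebraMap F U w.2) := by
  induction a using enveloping_induction (lieSpan_range_symm_of e) generalizing w with
  | hι y hy =>
    obtain ⟨x, rfl⟩ := hy
    rw [derivationAction_ι, map_zero, add_zero, map_add, map_smul, mul_add, smul_eq_mul,
      ← algebraMap_smul U w.2, map_smul, Finsupp.linearCombination_single, one_smul, smul_eq_mul,
      Algebra.commutes]
  | halg c =>
    rw [AlgHom.commutes, Module.algebraMap_end_apply, Prod.smul_fst, Prod.smul_snd,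
      ← algebraMap_smul U c w.1, map_smul, smul_eq_mul, smul_eq_mul, map_mul, mul_add]
  | hadd a b ha hb =>
    rw [map_add, LinearMap.add_apply, Prod.fst_add, Prod.snd_add, map_add, map_add,
      add_add_add_comm, ha, hb, add_mul]
  | hmul a b ha hb => rw [map_mul, Module.End.mul_apply, ha, hb, mul_assoc]

/-- On `I` the term `ε(a)` disappears: the derivation becomes `U`-linear, and Fox's formula makes it
a section of `U^(X) → I`. -/
theorem projective_ker_augmentationLinear (e : L ≃ₗ⁅F⁆ FreeLieAlgebra F X) :
    Module.Projective U (LinearMap.ker (augmentationLinear F L)) := by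
  let s : LinearMap.ker (augmentationLinear F L) →ₗ[U] X →₀ U :=
    { toFun := fun a => (derivationAction e (a : U) (0, 1)).1
      map_add' := fun a b => by
        rw [Submodule.coe_add, map_add, LinearMap.add_apply, Prod.fst_add]
      map_smul' := fun a b => by
        have hb : derivationAction e (b : U) (0, 1) = ((derivationAction e (b : U) (0, 1)).1, 0) :=
          Prod.ext rfl (by
            rw [snd_derivationAction, mem_ker_augmentationLinear.mp b.2, zero_mul])
        rw [Submodule.coe_smul, smul_eq_mul, map_mul, Module.End.mul_apply, hb,
          derivationAction_inl, RingHom.id_apply] }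
  refine Module.Projective.of_split s
    (toAugmentationIdeal fun x => e.symm (FreeLieAlgebra.of F x)) (LinearMap.ext fun a => ?_)
  refine Subtype.ext ?_
  have h := linearCombination_derivationAction e (a : U) (0, 1)
  rw [snd_derivationAction, mem_ker_augmentationLinear.mp a.2, zero_mul, map_zero, add_zero,
    map_zero, zero_add, map_one, mul_one] at h
  exact h

theorem subsingleton_cohomology_two_of_free (e : L ≃ₗ⁅F⁆ FreeLieAlgebra F X) :
    Subsingleton (Cohomology F L 2) :=
  have := projective_ker_augmentationLinear e
  subsingleton_ext_two_of_projective_ker augmentationLinear_surjective (trivialModule F L)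

end Free

/-! ### The free Lie algebra on a vector space and on a basis. -/

section FreeLieOn

variable {F : Type u} [Field F] {V : Type v} [AddCommGroup V] [Module F V] {M : Type w}
  [LieRing M] [LieAlgebra F M]

variable (F V) in
/-- The inclusion of `V` in the free Lie algebra on `V`. -/
def FreeLieOn.of : V →ₗ[F] FreeLieOn F V where
  toFun x := LieSubmodule.Quotient.mk (FreeLieAlgebra.of F x)
  map_add' x y := (Submodule.Quotient.eq _).mpr
    (LieSubmodule.subset_lieSpan (Or.inl ⟨x, y, rfl⟩))
  map_smul' c x := (Submodule.Quotient.eq _).mpr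
    (LieSubmodule.subset_lieSpan (Or.inr ⟨c, x, rfl⟩))

@[simp]
theorem FreeLieOn.lift_of (f : V →ₗ[F] M) (x : V) :
    FreeLieOn.lift f (FreeLieOn.of F V x) = f x :=
  FreeLieAlgebra.lift_of_apply _ _

theorem FreeLieOn.hom_ext {f g : FreeLieOn F V →ₗ⁅F⁆ M}
    (h : ∀ x, f (FreeLieOn.of F V x) = g (FreeLieOn.of F V x)) : f = g := by
  let q : FreeLieAlgebra F V →ₗ⁅F⁆ FreeLieOn F V :=
    { ((LieSubmodule.Quotient.mk' (linearityIdeal F V) : _ →ₗ⁅F, FreeLieAlgebra F V⁆ _) :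
        FreeLieAlgebra F V →ₗ[F] FreeLieOn F V) with
      map_lie' := fun {x y} => LieSubmodule.Quotient.mk_bracket _ x y }
  have h' : f.comp q = g.comp q := FreeLieAlgebra.hom_ext h
  ext z
  obtain ⟨z, rfl⟩ := LieSubmodule.Quotient.surjective_mk' (linearityIdeal F V) z
  exact DFunLike.congr_fun h' z

/-- The free Lie algebra on a vector space is the free Lie algebra on a basis. -/
def FreeLieOn.equivOfBasis {B : Type*} (b : Module.Basis B F V) :
    FreeLieOn F V ≃ₗ⁅F⁆ FreeLieAlgebra F B :=
  { FreeLieOn.lift (b.constr F (FreeLieAlgebra.of F)) with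
    invFun := FreeLieAlgebra.lift F fun i => FreeLieOn.of F V (b i)
    left_inv := DFunLike.congr_fun
      (f := (FreeLieAlgebra.lift F fun i => FreeLieOn.of F V (b i)).comp
        (FreeLieOn.lift (b.constr F (FreeLieAlgebra.of F)))) (g := LieHom.id) <| by
      refine FreeLieOn.hom_ext fun x => ?_
      rw [LieHom.comp_apply, FreeLieOn.lift_of]
      have : ((FreeLieAlgebra.lift F fun i => FreeLieOn.of F V (b i)) : _ →ₗ[F] FreeLieOn F V) ∘ₗ
          b.constr F (FreeLieAlgebra.of F) = FreeLieOn.of F V := b.ext fun i => by simp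
      exact DFunLike.congr_fun this x
    right_inv := DFunLike.congr_fun (f := (FreeLieOn.lift (b.constr F (FreeLieAlgebra.of F))).comp
        (FreeLieAlgebra.lift F fun i => FreeLieOn.of F V (b i))) (g := LieHom.id) <| by
      ext i
      simp }

theorem FreeLieOn.equivOfBasis_symm_of {B : Type*} (b : Module.Basis B F V) (i : B) :
    (FreeLieOn.equivOfBasis b).symm (FreeLieAlgebra.of F i) = FreeLieOn.of F V (b i) :=
  FreeLieAlgebra.lift_of_apply _ _

end FreeLieOn

/-! ### The canonical homomorphism. -/

section Main

variable {F : Type u} [Field F] {L : Type v} [LieRing L] [LieAlgebra F L]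
  (ℒ : ℕ → Submodule F L)

theorem canonicalHom_of (x : ℒ 1) : canonicalHom ℒ (FreeLieOn.of F (ℒ 1) x) = x :=
  FreeLieOn.lift_of _ x

variable {ℒ}

theorem canonicalHom_surjective (h1 : IsOneGenerated ℒ) :
    Function.Surjective (canonicalHom ℒ) := by
  rw [← LieHom.range_eq_top, eq_top_iff,
    ← show LieSubalgebra.lieSpan F L (ℒ 1 : Set L) = ⊤ from h1, LieSubalgebra.lieSpan_le]
  exact fun x hx => ⟨FreeLieOn.of F (ℒ 1) ⟨x, hx⟩, canonicalHom_of ℒ _⟩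

theorem canonicalHom_injective [GradedLieAlgebra ℒ] (h0 : ℒ 0 = ⊥) (h1 : IsOneGenerated ℒ)
    (hH : Subsingleton (Cohomology F L 2)) : Function.Injective (canonicalHom ℒ) := by
  let b := Module.Basis.ofVectorSpace F (ℒ 1)
  have hinj : Function.Injective
      (FreeAlgebra.lift F fun i => UniversalEnvelopingAlgebra.ι F (b i : L)) :=
    lift_injective_of_linearCombination_injective (augmentation F L)
      (fun i => augmentation_ι _) fun f g h =>
        toAugmentationIdeal_injective h0 h1 b hH (Subtype.ext h)
  -- Both routes from the free Lie algebra to `U` agree on letters; the one through the free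
  -- associative algebra is injective.
  have hcomp : (FreeAlgebra.lift F fun i => UniversalEnvelopingAlgebra.ι F
      (b i : L)).toLieHom.comp (toFreeAlgebra F _) = (UniversalEnvelopingAlgebra.ι F).comp
        ((canonicalHom ℒ).comp ((FreeLieOn.equivOfBasis b).symm : _ →ₗ⁅F⁆ FreeLieOn F (ℒ 1))) := by
    refine FreeLieAlgebra.hom_ext fun i => ?_
    simp only [LieHom.comp_apply, toFreeAlgebra_of, AlgHom.coe_toLieHom, LieEquiv.coe_toLieHom,
      FreeLieOn.equivOfBasis_symm_of, canonicalHom_of, FreeAlgebra.lift_ι_apply]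
  intro x y hxy
  apply (FreeLieOn.equivOfBasis b).injective
  apply toFreeAlgebra_injective
  apply hinj
  have h := fun z => DFunLike.congr_fun hcomp (FreeLieOn.equivOfBasis b z)
  simp only [LieHom.comp_apply, AlgHom.coe_toLieHom, LieEquiv.coe_toLieHom,
    LieEquiv.symm_apply_apply] at h
  refine (h x).trans (Eq.trans ?_ (h y).symm)
  rw [hxy]

theorem nonempty_equiv_free_of_bijective (h : Function.Bijective (canonicalHom ℒ)) :
    ∃ X : Type v, Nonempty (L ≃ₗ⁅F⁆ FreeLieAlgebra F X) :=
  ⟨_, ⟨(LieEquiv.ofBijective (canonicalHom ℒ) h).symm.trans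
    (FreeLieOn.equivOfBasis (Module.Basis.ofVectorSpace F (ℒ 1)))⟩⟩

end Main

end GradedLie

end

theorem theorem5p2 {F : Type u} [Field F] {L : Type v} [LieRing L] [LieAlgebra F L]
    (ℒ : ℕ → Submodule F L) [GradedLieAlgebra ℒ] (h0 : ℒ 0 = ⊥)
    (h1 : GradedLie.IsOneGenerated ℒ) :
    (Subsingleton (GradedLie.Cohomology F L 2) ↔
      Function.Bijective (GradedLie.canonicalHom ℒ)) ∧
    (Subsingleton (GradedLie.Cohomology F L 2) ↔
      ∃ X : Type v, Nonempty (L ≃ₗ⁅F⁆ FreeLieAlgebra F X)) := by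
  have hbij (hH : Subsingleton (GradedLie.Cohomology F L 2)) :
      Function.Bijective (GradedLie.canonicalHom ℒ) :=
    ⟨GradedLie.canonicalHom_injective h0 h1 hH, GradedLie.canonicalHom_surjective h1⟩
  have hfree : (∃ X : Type v, Nonempty (L ≃ₗ⁅F⁆ FreeLieAlgebra F X)) →
      Subsingleton (GradedLie.Cohomology F L 2) :=
    fun ⟨_, ⟨e⟩⟩ => GradedLie.subsingleton_cohomology_two_of_free e
  exact ⟨⟨hbij, fun h => hfree (GradedLie.nonempty_equiv_free_of_bijective h)⟩,
    ⟨fun hH => GradedLie.nonempty_equiv_free_of_bijective (hbij hH), hfree⟩⟩
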